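/- Consider a finite lexicographic MDP (LMDP): finite sets $\mathcal S$ (states), $\mathcal A$ (actions), $\mathcal E$ (events), a joint law $\mathbb P(s',e\mid s,a)$ of next state and event, vector rewards $r:\mathcal E\to\mathbb R^d$ and reward multipliers $\Gamma:\mathcal E\to\mathbb R^{d\times d}$ such that each $\Gamma(e)$ is either $0$ or a lower triangular matrix with positive diagonal entries. The return of a finite event sequence is given by $u(\varepsilon)=0$ and $u(e\cdot\tau)=r(e)+\Gamma(e)u(\tau)$. For a (possibly randomized and history-dependent) policy $\pi$, let $V^\pi(s)=\lim_{N\to\infty}\mathbb E_\pi[u(e_0,\dots,e_{N-1})\mid s_0=s]$, and let $Q^\pi(s,a)$ be defined in the same way, conditioning also on $a_0=a$, with $\pi$ followed thereafter. Vectors in $\mathbb R^d$ are compared lexicographically. Theorem (Fundamental Theorem of LMDPs). Assume $\Gamma_{i,i}(e)<1$ for all $e\in\mathcal E$ and $i\in\{1,\dots,d\}$. Then the limits defining $V^\pi$ and $Q^\pi$ exist for every policy. Let $\mathcal C$ be any class of policies that contains all stationary randomized policies $\pi:\mathcal S\to\Delta(\mathcal A)$ (for instance the class of exactly these, or the class of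 all history-dependent randomized policies). Then $Q^\star(s,a)=\operatorname{lexmax}_{\pi\in\mathcal C}Q^\pi(s,a)$ exists for all $s,a$, and a stationary policy $\pi:\mathcal S\to\Delta(\mathcal A)$ is uniformly optimal, that is, $V^{\pi}(s)\ge_{\mathrm{lex}}V^{\pi'}(s)$ for all $s\in\mathcal S$ and all $\pi'\in\mathcal C$, if and only if it is greedy with respect to $Q^\star$, that is, $\mathbb E_{a\sim\pi(s)}[Q^\star(s,a)]=\operatorname{lexmax}_{a}Q^\star(s,a)$ for all $s\in\mathcal S$. In that case, moreover, $Q^\pi=Q^\star$. -/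

import Mathlib

open Filter Topology

noncomputable section

/-- Lower triangular real `d × d` matrices with positive diagonal entries. -/
def lowerTriangularPos (d : ℕ) : Set (Matrix (Fin d) (Fin d) ℝ) :=
  {M | (∀ i j, i < j → M i j = 0) ∧ ∀ i, 0 < M i i}

/-- A lexicographic Markov decision process with states `S`, actions `A`, events `E` and
`d`-dimensional rewards. Given the current state and action, the next state and an event are
drawn jointly; the event carries the reward vector and the reward multiplier
(the matrix "discount"), which is `0` precisely for terminal events. -/
structure LMDP (S A E : Type*) (d : ℕ) where
  /-- joint law of the next state and the event -/
  trans : S → A → PMF (S × E)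
  /-- vector reward of an event -/
  reward : E → Fin d → ℝ
  /-- reward multiplier of an event -/
  mult : E → Matrix (Fin d) (Fin d) ℝ
  mult_mem : ∀ e, mult e ∈ lowerTriangularPos d ∪ {0}

/-- A (randomized, possibly history-dependent) policy: given the past steps
(state, action, event), oldest first, and the current state, a law of the next action. -/
abbrev Policy (S A E : Type*) := List (S × A × E) → S → PMF A

/-- The stationary randomized policy given by `π : S → Δ(A)`. -/
def stationary {S A : Type*} (E : Type*) (π : S → PMF A) : Policy S A E := fun _ => π

/-- The policy that `π` prescribes once the first step `(s, a, e)` has been made. -/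
def Policy.after {S A E : Type*} (π : Policy S A E) (s : S) (a : A) (e : E) : Policy S A E :=
  fun h => π ((s, a, e) :: h)

/-- Expectation of a vector-valued function under a discrete law. -/
def expect {α : Type*} {d : ℕ} (p : PMF α) (f : α → Fin d → ℝ) : Fin d → ℝ :=
  ∑' x, (p x).toReal • f x

namespace LMDP

variable {S A E : Type*} {d : ℕ}

/-- Utility (return) of a finite sequence of events:
`u(ε) = 0` and `u(e · τ) = r(e) + Γ(e) u(τ)`; that is,
`u(e₀, …, eₙ) = ∑ₜ Γ(e₀) ⋯ Γ(eₜ₋₁) r(eₜ)`. -/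
def utility (M : LMDP S A E d) : List E → Fin d → ℝ
  | [] => 0
  | e :: τ => M.reward e + (M.mult e).mulVec (M.utility τ)

/-- Law of the first `N` events when starting in `s` and following `π`. -/
def eventLaw (M : LMDP S A E d) : ℕ → Policy S A E → S → PMF (List E)
  | 0, _, _ => PMF.pure []
  | N + 1, π, s => (π [] s).bind fun a => (M.trans s a).bind fun x =>
      (M.eventLaw N (π.after s a x.2) x.1).map fun τ => x.2 :: τ

/-- Law of the first `N + 1` events when starting in `s`, taking action `a`, and following `π`
thereafter. -/
def eventLawAct (M : LMDP S A E d) (N : ℕ) (π : Policy S A E) (s : S) (a : A) : PMF (List E) :=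
  (M.trans s a).bind fun x =>
    (M.eventLaw N (π.after s a x.2) x.1).map fun τ => x.2 :: τ

/-- Value function `V^π(s)`: infinite-horizon expected return. -/
def V (M : LMDP S A E d) (π : Policy S A E) (s : S) : Fin d → ℝ :=
  limUnder atTop fun N => expect (M.eventLaw N π s) M.utility

/-- Q-function `Q^π(s, a)`: infinite-horizon expected return after starting in `s`, taking
action `a`, and following `π` thereafter. -/
def Q (M : LMDP S A E d) (π : Policy S A E) (s : S) (a : A) : Fin d → ℝ :=
  limUnder atTop fun N => expect (M.eventLawAct N π s a) M.utility

/-- `Qstar(s, a)` is the lexicographic maximum of `Q^π(s, a)` over the policies `π ∈ C`. -/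
def IsOptimalQ (M : LMDP S A E d) (C : Set (Policy S A E)) (Qstar : S → A → Fin d → ℝ) : Prop :=
  ∀ s a, IsGreatest ((fun π => toLex (M.Q π s a)) '' C) (toLex (Qstar s a))

/-- `π` is lexicographically optimal among the policies in `C`, from every start state. -/
def IsUniformlyOptimal (M : LMDP S A E d) (C : Set (Policy S A E)) (π : Policy S A E) : Prop :=
  ∀ s, ∀ π' ∈ C, toLex (M.V π' s) ≤ toLex (M.V π s)

end LMDP

/-- `π` is greedy for `q`: in every state `s`, the mean of `q(s, a)` for `a ∼ π(s)` is the
lexicographic maximum of `q(s, a)` over all actions `a`. -/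
def IsGreedy {S A : Type*} {d : ℕ} (q : S → A → Fin d → ℝ) (π : S → PMF A) : Prop :=
  ∀ s, IsGreatest (Set.range fun a => toLex (q s a)) (toLex (expect (π s) (q s)))

end

open Matrix

/-! ### Lexicographic nonnegativity -/

/-! The lexicographic order is not closed, so lexicographic inequalities do not survive limits.
Contraction (`exists_weight_contraction`) is therefore used only for convergence and uniform bounds.
Order statements come from a maximum principle, `lexNonneg_of_sub_average`, proved one coordinate at
a time, where only closed real inequalities are passed to the limit.

Applied to pairs (remaining policy, state), it shows that a solution of the Bellman inequalities
dominates every history-dependent policy (`lexNonneg_sub_V`). Such a solution comes from policy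
improvement: among the finitely many deterministic stationary policies take one with maximal value;
a greedy improvement cannot beat it, so it solves the optimality equation
(`exists_bellman_optimal`). Its Q-function is the optimal one, and uniqueness of Bellman fixed
points (`V_stationary_eq`) identifies the value of every greedy policy. -/

/-- The first nonzero entry among the first `n` entries of `x`, if any, is positive. -/
def LexNonnegBelow {d : ℕ} (n : ℕ) (x : Fin d → ℝ) : Prop :=
  ∀ k : Fin d, k.val < n → (∀ j < k, x j = 0) → 0 ≤ x k

/-- The first nonzero entry of `x`, if any, is positive. -/
def LexNonneg {d : ℕ} (x : Fin d → ℝ) : Prop :=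
  ∀ k : Fin d, (∀ j < k, x j = 0) → 0 ≤ x k

section Lex

variable {d : ℕ}

theorem LexNonneg.below {x : Fin d → ℝ} (h : LexNonneg x) (n : ℕ) : LexNonnegBelow n x :=
  fun k _ => h k

theorem toLex_le_toLex_iff_lexNonneg {x y : Fin d → ℝ} :
    toLex x ≤ toLex y ↔ LexNonneg (y - x) := by
  constructor
  · intro h k hk
    rcases h.eq_or_lt with h | h
    · rw [toLex_inj.1 h]; simp
    · obtain ⟨i, hi, hlt⟩ := h
      rcases lt_trichotomy k i with hki | rfl | hki
      · have := hi k hki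
        simp only [Pi.toLex_apply] at this
        simp [this]
      · simp only [Pi.toLex_apply] at hlt
        simp [hlt.le]
      · have := hk i hki
        simp only [Pi.toLex_apply] at hlt
        simp only [Pi.sub_apply] at this
        linarith
  · intro h
    by_contra hlt
    obtain ⟨i, hi, hlt⟩ := not_le.1 hlt
    have := h i fun j hj => by
      have := hi j hj
      simp only [Pi.toLex_apply] at this
      simp [this]
    simp only [Pi.toLex_apply] at hlt
    simp only [Pi.sub_apply] at this
    linarith

theorem LexNonnegBelow.smul {n : ℕ} {x : Fin d → ℝ} (h : LexNonnegBelow n x) {c : ℝ}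
    (hc : 0 ≤ c) : LexNonnegBelow n (c • x) := by
  intro k hk hz
  rcases hc.eq_or_lt with rfl | hc
  · simp
  · refine mul_nonneg hc.le (h k hk fun j hj => ?_)
    simpa [hc.ne'] using hz j hj

theorem mulVec_apply_of_lowerTriangular {M : Matrix (Fin d) (Fin d) ℝ}
    (hM : M ∈ lowerTriangularPos d) {x : Fin d → ℝ} {k : Fin d} (hx : ∀ j < k, x j = 0) :
    (M *ᵥ x) k = M k k * x k := by
  rw [Matrix.mulVec, dotProduct]
  refine Finset.sum_eq_single k (fun j _ hj => ?_) (by simp)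
  rcases lt_or_gt_of_ne hj with h | h
  · simp [hx j h]
  · simp [hM.1 k j h]

/-- Forward substitution: the diagonal entries are nonzero. -/
theorem eq_zero_of_mulVec_eq_zero {M : Matrix (Fin d) (Fin d) ℝ}
    (hM : M ∈ lowerTriangularPos d) {x : Fin d → ℝ} {k : Fin d}
    (hx : ∀ j < k, (M *ᵥ x) j = 0) (j : Fin d) (hj : j < k) : x j = 0 := by
  induction j using WellFoundedLT.induction with
  | ind j ih =>
    have h := hx j hj
    rw [mulVec_apply_of_lowerTriangular hM fun l hl => ih l hl (hl.trans hj)] at h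
    exact (mul_eq_zero.1 h).resolve_left (hM.2 j).ne'

theorem LexNonnegBelow.mulVec {n : ℕ} {M : Matrix (Fin d) (Fin d) ℝ}
    (hM : M ∈ lowerTriangularPos d ∪ {0}) {x : Fin d → ℝ} (h : LexNonnegBelow n x) :
    LexNonnegBelow n (M *ᵥ x) := by
  rcases hM with hM | rfl
  · intro k hk hz
    have hx := eq_zero_of_mulVec_eq_zero hM hz
    rw [mulVec_apply_of_lowerTriangular hM hx]
    exact mul_nonneg (hM.2 k).le (h k hk hx)
  · intro k _ _
    simp

/-- Lexicographically nonnegative vectors cannot cancel: once earlier coordinates vanish, the next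
ones are nonnegative reals, so a zero sum kills each of them. -/
theorem LexNonnegBelow.eq_zero_of_sum {ι : Type*} {t : Finset ι} {n : ℕ} {x : ι → Fin d → ℝ}
    (h : ∀ i ∈ t, LexNonnegBelow n (x i)) {k : Fin d} (hk : k.val ≤ n)
    (hz : ∀ j < k, (∑ i ∈ t, x i) j = 0) {i : ι} (hi : i ∈ t) (j : Fin d) (hj : j < k) :
    x i j = 0 := by
  induction j using WellFoundedLT.induction generalizing i with
  | ind j ih =>
    have hs := hz j hj
    rw [Finset.sum_apply] at hs
    exact (Finset.sum_eq_zero_iff_of_nonneg fun i hi =>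
      h i hi j (lt_of_lt_of_le hj hk) fun l hl => ih l hl hi (hl.trans hj)).1 hs i hi

theorem LexNonneg.sum {ι : Type*} {t : Finset ι} {x : ι → Fin d → ℝ}
    (h : ∀ i ∈ t, LexNonneg (x i)) : LexNonneg (∑ i ∈ t, x i) := by
  intro k hz
  rw [Finset.sum_apply]
  exact Finset.sum_nonneg fun i hi => h i hi k fun j hj =>
    LexNonnegBelow.eq_zero_of_sum (fun i hi => (h i hi).below k.val) le_rfl hz hi j hj

theorem LexNonneg.smul {x : Fin d → ℝ} (h : LexNonneg x) {c : ℝ} (hc : 0 ≤ c) :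
    LexNonneg (c • x) :=
  fun k hz => LexNonnegBelow.smul (h.below (k.val + 1)) hc k k.val.lt_succ_self hz

theorem LexNonneg.mulVec {M : Matrix (Fin d) (Fin d) ℝ} (hM : M ∈ lowerTriangularPos d ∪ {0})
    {x : Fin d → ℝ} (h : LexNonneg x) : LexNonneg (M *ᵥ x) :=
  fun k hz => LexNonnegBelow.mulVec hM (h.below (k.val + 1)) k k.val.lt_succ_self hz

theorem lexNonneg_zero : LexNonneg (0 : Fin d → ℝ) := fun _ _ => le_rfl

theorem exists_uniform_bound_lt_one {ι : Type*} [Finite ι] {f : ι → ℝ} (hf : ∀ i, f i < 1) :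
    ∃ γ : ℝ, 0 ≤ γ ∧ γ < 1 ∧ ∀ i, f i ≤ γ := by
  have h1 : ∀ᶠ γ in 𝓝[<] (1 : ℝ), ∀ i, f i ≤ γ := eventually_all.2 fun i =>
    (eventually_nhdsWithin_of_eventually_nhds (eventually_gt_nhds (hf i))).mono fun _ h => h.le
  have h2 : ∀ᶠ γ in 𝓝[<] (1 : ℝ), 0 < γ :=
    eventually_nhdsWithin_of_eventually_nhds (eventually_gt_nhds one_pos)
  have h3 : ∀ᶠ γ in 𝓝[<] (1 : ℝ), γ < 1 := eventually_mem_nhdsWithin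
  obtain ⟨γ, ha, hb, hc⟩ := (h1.and (h2.and h3)).exists
  exact ⟨γ, hb.le, hc, ha⟩

/-- Maximum principle: a bounded vector-valued function that dominates, lexicographically, its own
discounted average over successors is lexicographically nonnegative. -/
theorem lexNonneg_of_sub_average {X ι : Type*} [Fintype ι] {D : X → Fin d → ℝ} {B : ℝ}
    (hB : ∀ x, ‖D x‖ ≤ B) {p : X → ι → ℝ} (hp : ∀ x i, 0 ≤ p x i) (hp1 : ∀ x, ∑ i, p x i = 1)
    {G : ι → Matrix (Fin d) (Fin d) ℝ} (hG : ∀ i, G i ∈ lowerTriangularPos d ∪ {0})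
    (hdisc : ∀ i k, G i k k < 1) {next : X → ι → X}
    (h : ∀ x, LexNonneg (D x - ∑ i, p x i • G i *ᵥ D (next x i))) (x : X) :
    LexNonneg (D x) := by
  obtain ⟨γ, hγ0, hγ1, hγ⟩ := exists_uniform_bound_lt_one (ι := ι × Fin d)
    (f := fun q => G q.1 q.2 q.2) fun q => hdisc _ _
  suffices H : ∀ n x, LexNonnegBelow n (D x) from fun k => H (k.val + 1) x k k.val.lt_succ_self
  intro n
  induction n with
  | zero => exact fun x k hk => absurd hk (Nat.not_lt_zero _)
  | succ n ih =>
    intro x k hk hx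
    rcases (Nat.lt_succ_iff.1 hk).lt_or_eq with hk | hk
    · exact ih x k hk hx
    have hB0 : 0 ≤ B := (norm_nonneg _).trans (hB x)
    -- A lower bound on coordinate `k`, valid wherever the earlier coordinates vanish, improves by a
    -- factor `γ` at each step, because that vanishing passes to every successor that matters.
    have key : ∀ m : ℕ, ∀ x, (∀ j < k, D x j = 0) → -(γ ^ m * B) ≤ D x k := by
      intro m
      induction m with
      | zero =>
        intro x _
        have := (abs_le.1 ((norm_le_pi_norm (D x) k).trans (hB x))).1
        simpa using this
      | succ m ihm =>
        intro x hx
        -- The defect is the `none` summand, so that `D x` becomes one sum of nonnegative terms.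
        let t : Option ι → Fin d → ℝ := fun o => o.elim
          (D x - ∑ i, p x i • G i *ᵥ D (next x i)) fun i => p x i • G i *ᵥ D (next x i)
        have ht : ∑ o, t o = D x := by simp [t, Fintype.sum_option]
        have hnn : ∀ o ∈ Finset.univ, LexNonnegBelow n (t o) := by
          rintro (_ | i) -
          · exact (h x).below n
          · exact ((ih _).mulVec (hG i)).smul (hp x i)
        have hz : ∀ o, ∀ j < k, t o j = 0 := fun o =>
          LexNonnegBelow.eq_zero_of_sum hnn hk.le (by rwa [ht]) (Finset.mem_univ o)
        have h0 : 0 ≤ t none k := h x k (hz none)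
        have h1 : ∀ i, p x i * -(γ ^ (m + 1) * B) ≤ t (some i) k := by
          intro i
          have hneg : -(γ ^ (m + 1) * B) ≤ 0 := neg_nonpos.2 (by positivity)
          -- With probability zero, nothing is known about the successor, but its term vanishes.
          rcases (hp x i).eq_or_lt with hpi | hpi
          · simp [t, ← hpi]
          change _ ≤ p x i * (G i *ᵥ D (next x i)) k
          refine mul_le_mul_of_nonneg_left ?_ hpi.le
          rcases hG i with hGi | hGi
          · have hD : ∀ j < k, D (next x i) j = 0 :=
              eq_zero_of_mulVec_eq_zero hGi fun j hj => by
                have := hz (some i) j hj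
                change p x i * (G i *ᵥ D (next x i)) j = 0 at this
                exact (mul_eq_zero.1 this).resolve_left hpi.ne'
            rw [mulVec_apply_of_lowerTriangular hGi hD]
            calc -(γ ^ (m + 1) * B) = γ * -(γ ^ m * B) := by ring
              _ ≤ G i k k * -(γ ^ m * B) :=
                mul_le_mul_of_nonpos_right (hγ (i, k)) (neg_nonpos.2 (by positivity))
              _ ≤ _ := mul_le_mul_of_nonneg_left (ihm _ hD) (hGi.2 k).le
          · rw [Set.mem_singleton_iff] at hGi
            simpa [hGi] using hneg
        calc -(γ ^ (m + 1) * B) = ∑ i, p x i * -(γ ^ (m + 1) * B) := by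
              rw [← Finset.sum_mul, hp1, one_mul]
          _ ≤ ∑ i, t (some i) k := Finset.sum_le_sum fun i _ => h1 i
          _ ≤ t none k + ∑ i, t (some i) k := le_add_of_nonneg_left h0
          _ = D x k := by
            conv_rhs => rw [← ht]
            rw [Fintype.sum_option, Pi.add_apply, Finset.sum_apply]
    have hlim : Tendsto (fun m : ℕ => -(γ ^ m * B)) atTop (𝓝 0) := by
      simpa using ((tendsto_pow_atTop_nhds_zero_of_lt_one hγ0 hγ1).mul_const B).neg
    exact le_of_tendsto' hlim fun m => key m x hx

/-- Finitely many lower triangular matrices whose diagonal entries have absolute value less than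
one are contractions for a common weighted sup norm. -/
theorem exists_weight_contraction {ι : Type*} [Finite ι] {G : ι → Matrix (Fin d) (Fin d) ℝ}
    (hG : ∀ i, G i ∈ lowerTriangularPos d ∪ {0}) (hdisc : ∀ i k, G i k k < 1) :
    ∃ (w : Fin d → ℝ) (β : ℝ), (∀ k, 0 < w k) ∧ 0 ≤ β ∧ β < 1 ∧
      ∀ i x, ‖w * (G i *ᵥ x)‖ ≤ β * ‖w * x‖ := by
  obtain ⟨γ, hγ0, hγ1, hγ⟩ := exists_uniform_bound_lt_one (ι := ι × Fin d)
    (f := fun q => G q.1 q.2 q.2) fun q => hdisc _ _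
  obtain ⟨C, hC⟩ := (Set.finite_range fun q : ι × Fin d => ∑ j, |G q.1 q.2 j|).bddAbove
  have hC' : ∀ i k, ∑ j, |G i k j| ≤ max C 0 := fun i k =>
    (hC ⟨(i, k), rfl⟩).trans (le_max_left _ _)
  set K := max C 0
  have hK : 0 ≤ K := le_max_right _ _
  have hnn : ∀ i k, 0 ≤ G i k k := by
    intro i k
    rcases hG i with h | h
    · exact (h.2 k).le
    · rw [Set.mem_singleton_iff] at h
      simp [h]
  have htri : ∀ i k j, k < j → G i k j = 0 := by
    intro i k j hkj
    rcases hG i with h | h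
    · exact h.1 k j hkj
    · rw [Set.mem_singleton_iff] at h
      simp [h]
  -- This makes `γ + ε * K = 1 - ε < 1`. With weights `ε ^ k`, each subdiagonal entry gains at least
  -- one factor `ε`.
  set ε := (1 - γ) / (K + 1)
  have hε0 : 0 < ε := div_pos (by linarith) (by linarith)
  have hεK : ε * (K + 1) = 1 - γ := div_mul_cancel₀ _ (by linarith)
  have hε1 : ε ≤ 1 := by nlinarith
  refine ⟨fun k => ε ^ k.val, γ + ε * K, fun k => by positivity, by positivity, by nlinarith,
    fun i x => ?_⟩
  set w : Fin d → ℝ := fun k => ε ^ k.val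
  have hterm : ∀ k j, |w k * (G i k j * x j)| ≤
      (if k = j then γ * ‖w * x‖ else 0) + ε * ‖w * x‖ * |G i k j| := by
    intro k j
    have hx : w j * |x j| ≤ ‖w * x‖ := by
      have := norm_le_pi_norm (w * x) j
      rwa [Pi.mul_apply, norm_mul, Real.norm_of_nonneg (by positivity : 0 ≤ w j)] at this
    have hn := norm_nonneg (w * x)
    have hw : ∀ k, 0 < w k := fun k => pow_pos hε0 _
    rw [abs_mul, abs_mul, abs_of_pos (hw k)]
    rcases lt_trichotomy k j with hkj | rfl | hkj
    · simp [htri i k j hkj, hkj.ne]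
    · rw [if_pos rfl, abs_of_nonneg (hnn i k)]
      have : G i k k * (w k * |x k|) ≤ γ * ‖w * x‖ :=
        mul_le_mul (hγ (i, k)) hx (by have := hw k; positivity) hγ0
      have h2 : 0 ≤ ε * ‖w * x‖ * G i k k := by have := hnn i k; positivity
      nlinarith
    · rw [if_neg hkj.ne', zero_add]
      have hwk : w k ≤ ε * w j := by
        rw [← pow_succ']
        exact pow_le_pow_of_le_one hε0.le hε1 (Nat.succ_le_of_lt hkj)
      calc w k * (|G i k j| * |x j|) ≤ ε * w j * (|G i k j| * |x j|) :=
            mul_le_mul_of_nonneg_right hwk (by positivity)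
        _ = ε * (w j * |x j|) * |G i k j| := by ring
        _ ≤ ε * ‖w * x‖ * |G i k j| := by gcongr
  refine (pi_norm_le_iff_of_nonneg (by positivity)).2 fun k => ?_
  rw [Pi.mul_apply, Matrix.mulVec, dotProduct, Finset.mul_sum, Real.norm_eq_abs]
  calc |∑ j, w k * (G i k j * x j)| ≤ ∑ j, |w k * (G i k j * x j)| :=
        Finset.abs_sum_le_sum_abs _ _
    _ ≤ ∑ j, ((if k = j then γ * ‖w * x‖ else 0) + ε * ‖w * x‖ * |G i k j|) :=
      Finset.sum_le_sum fun j _ => hterm k j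
    _ = γ * ‖w * x‖ + ε * ‖w * x‖ * ∑ j, |G i k j| := by
      rw [Finset.sum_add_distrib, Finset.sum_ite_eq, ← Finset.mul_sum]
      simp
    _ ≤ γ * ‖w * x‖ + ε * ‖w * x‖ * K := by gcongr; exact hC' i k
    _ = (γ + ε * K) * ‖w * x‖ := by ring

end Lex

/-! ### Expectations under discrete laws -/

section Expect

variable {α β : Type*} {d : ℕ}

theorem PMF.sum_toReal [Fintype α] (p : PMF α) : ∑ a, (p a).toReal = 1 := by
  have h := p.tsum_coe
  rw [tsum_fintype] at h
  rw [← ENNReal.toReal_sum fun a _ => p.apply_ne_top a, h, ENNReal.toReal_one]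

theorem PMF.hasSum_toReal (p : PMF α) : HasSum (fun a => (p a).toReal) 1 := by
  have h := ENNReal.hasSum_toReal (f := p) p.tsum_coe_ne_top
  rwa [← ENNReal.tsum_toReal_eq p.apply_ne_top, p.tsum_coe, ENNReal.toReal_one] at h

theorem PMF.sum_smul_const [Fintype α] (p : PMF α) (v : Fin d → ℝ) :
    ∑ a, (p a).toReal • v = v := by
  rw [← Finset.sum_smul, p.sum_toReal, one_smul]

theorem expect_eq_sum [Fintype α] (p : PMF α) (f : α → Fin d → ℝ) :
    expect p f = ∑ a, (p a).toReal • f a :=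
  tsum_fintype _

theorem hasSum_pure (x : α) (f : α → Fin d → ℝ) :
    HasSum (fun y => (PMF.pure x y).toReal • f y) (f x) := by
  convert hasSum_single x (f := fun y => (PMF.pure x y).toReal • f y) fun y hy => ?_ using 1
  · simp
  · simp [PMF.pure_apply, hy]

theorem expect_pure (a : α) (f : α → Fin d → ℝ) : expect (PMF.pure a) f = f a :=
  (hasSum_pure a f).tsum_eq

theorem hasSum_bind [Fintype α] (p : PMF α) {q : α → PMF β} {f : β → Fin d → ℝ}
    {v : α → Fin d → ℝ} (h : ∀ a, HasSum (fun y => (q a y).toReal • f y) (v a)) :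
    HasSum (fun y => (p.bind q y).toReal • f y) (∑ a, (p a).toReal • v a) := by
  convert hasSum_sum fun a (_ : a ∈ Finset.univ) => (h a).const_smul (p a).toReal using 2 with y
  rw [PMF.bind_apply, tsum_fintype, ENNReal.toReal_sum fun a _ =>
    ENNReal.mul_ne_top (p.apply_ne_top a) ((q a).apply_ne_top y), Finset.sum_smul]
  simp [ENNReal.toReal_mul, mul_smul]

theorem hasSum_map_of_injective {p : PMF α} {g : α → β} (hg : Function.Injective g)
    {f : β → Fin d → ℝ} {v : Fin d → ℝ} (h : HasSum (fun x => (p x).toReal • f (g x)) v) :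
    HasSum (fun y => (p.map g y).toReal • f y) v := by
  classical
  refine (hg.hasSum_iff fun y hy => ?_).1 ?_
  · have : p.map g y = 0 := by
      rw [PMF.apply_eq_zero_iff, PMF.support_map]
      exact fun ⟨x, _, hx⟩ => hy ⟨x, hx⟩
    simp [this]
  · convert h using 2 with x
    have : p.map g (g x) = p x := by
      rw [PMF.map_apply, tsum_eq_single x fun x' hx' => if_neg fun e => hx' (hg e).symm,
        if_pos rfl]
    simp only [Function.comp_apply, this]

theorem norm_mul_sum_smul_le [Fintype α] (p : PMF α) {w : Fin d → ℝ} {v : α → Fin d → ℝ} {K : ℝ}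
    (h : ∀ a, ‖w * v a‖ ≤ K) : ‖w * ∑ a, (p a).toReal • v a‖ ≤ K := by
  rw [Finset.mul_sum]
  calc ‖∑ a, w * (p a).toReal • v a‖ ≤ ∑ a, (p a).toReal * K := by
        refine norm_sum_le_of_le _ fun a _ => ?_
        rw [mul_smul_comm, norm_smul, Real.norm_of_nonneg ENNReal.toReal_nonneg]
        exact mul_le_mul_of_nonneg_left (h a) ENNReal.toReal_nonneg
    _ = K := by rw [← Finset.sum_mul, p.sum_toReal, one_mul]

end Expect

/-! ### Bellman equations -/

namespace LMDP

variable {S A E : Type*} {d : ℕ}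

/-- Expected return of action `a` in state `s` if the continuation is worth `W (s', e)`. -/
noncomputable def backup [Fintype S] [Fintype E] (M : LMDP S A E d) (W : S × E → Fin d → ℝ)
    (s : S) (a : A) : Fin d → ℝ :=
  ∑ x, (M.trans s a x).toReal • (M.reward x.2 + M.mult x.2 *ᵥ W x)

/-- Expected return of the first `N` events. -/
noncomputable def valueUpTo (M : LMDP S A E d) (N : ℕ) (π : Policy S A E) (s : S) : Fin d → ℝ :=
  expect (M.eventLaw N π s) M.utility

theorem valueUpTo_zero (M : LMDP S A E d) (π : Policy S A E) (s : S) : M.valueUpTo 0 π s = 0 :=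
  (hasSum_pure _ _).tsum_eq

section Finite

variable [Fintype S] [Fintype E] (M : LMDP S A E d)

theorem backup_sub (W W' : S × E → Fin d → ℝ) (s : S) (a : A) :
    M.backup W s a - M.backup W' s a =
      ∑ x, (M.trans s a x).toReal • M.mult x.2 *ᵥ (W x - W' x) := by
  rw [backup, backup, ← Finset.sum_sub_distrib]
  refine Finset.sum_congr rfl fun x _ => ?_
  rw [← smul_sub, add_sub_add_left_eq_sub, Matrix.mulVec_sub]

/-- Lists of events form an infinite type, so `HasSum` is used to carry summability through the
recursion together with the value. -/
theorem hasSum_eventLawAct {N : ℕ} {π : Policy S A E} {s : S} {a : A} {v : S × E → Fin d → ℝ}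
    (h : ∀ x : S × E, HasSum (fun τ => (M.eventLaw N (π.after s a x.2) x.1 τ).toReal • M.utility τ)
      (v x)) :
    HasSum (fun τ => (M.eventLawAct N π s a τ).toReal • M.utility τ) (M.backup v s a) := by
  refine hasSum_bind _ fun x => hasSum_map_of_injective (List.cons_injective) ?_
  have h1 := (PMF.hasSum_toReal (M.eventLaw N (π.after s a x.2) x.1)).smul_const (M.reward x.2)
  have h2 : HasSum _ (M.mult x.2 *ᵥ v x) := (h x).mapL (LinearMap.toContinuousLinearMap (Matrix.mulVecLin (M.mult x.2)))
  rw [one_smul] at h1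
  convert h1.add h2 using 1
  ext1 τ
  simp [utility, smul_add]

theorem continuous_backup (s : S) (a : A) : Continuous fun W => M.backup W s a := by
  unfold backup
  fun_prop

variable [Fintype A]

theorem hasSum_eventLaw (N : ℕ) (π : Policy S A E) (s : S) :
    HasSum (fun τ => (M.eventLaw N π s τ).toReal • M.utility τ) (M.valueUpTo N π s) := by
  suffices H : ∃ v, HasSum (fun τ => (M.eventLaw N π s τ).toReal • M.utility τ) v from
    H.choose_spec.summable.hasSum
  induction N generalizing π s with
  | zero => exact ⟨_, hasSum_pure _ _⟩
  | succ N ih =>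
    choose v hv using ih
    exact ⟨_, hasSum_bind _ fun a => M.hasSum_eventLawAct fun x => hv (π.after s a x.2) x.1⟩

theorem expect_eventLawAct (N : ℕ) (π : Policy S A E) (s : S) (a : A) :
    expect (M.eventLawAct N π s a) M.utility =
      M.backup (fun x => M.valueUpTo N (π.after s a x.2) x.1) s a :=
  (M.hasSum_eventLawAct fun _ => M.hasSum_eventLaw _ _ _).tsum_eq

theorem valueUpTo_succ (N : ℕ) (π : Policy S A E) (s : S) :
    M.valueUpTo (N + 1) π s = ∑ a, (π [] s a).toReal •
      M.backup (fun x => M.valueUpTo N (π.after s a x.2) x.1) s a :=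
  (hasSum_bind _ fun _ => M.hasSum_eventLawAct fun _ => M.hasSum_eventLaw _ _ _).tsum_eq

end Finite

/-! ### Convergence -/

section Convergence

variable [Fintype S] [Fintype A] [Fintype E] (M : LMDP S A E d)

theorem exists_tendsto_valueUpTo (hdisc : ∀ (e : E) (i : Fin d), M.mult e i i < 1) :
    ∃ B : ℝ, ∀ (π : Policy S A E) (s : S), ∃ v,
      Tendsto (fun N => M.valueUpTo N π s) atTop (𝓝 v) ∧ ‖v‖ ≤ B := by
  obtain ⟨w, β, hw, hβ0, hβ1, hcontr⟩ := exists_weight_contraction M.mult_mem hdisc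
  obtain ⟨K, hK⟩ := (Set.finite_range fun e => ‖w * M.reward e‖).bddAbove
  -- The bound is uniform in `π`, as the induction passes to the policies `π.after`.
  have hstep : ∀ N (π : Policy S A E) s,
      ‖w * (M.valueUpTo (N + 1) π s - M.valueUpTo N π s)‖ ≤ K * β ^ N := by
    intro N
    induction N with
    | zero =>
      intro π s
      rw [valueUpTo_zero, sub_zero, valueUpTo_succ, pow_zero, mul_one]
      refine norm_mul_sum_smul_le _ fun a => norm_mul_sum_smul_le _ fun x => ?_
      simpa [valueUpTo_zero] using hK ⟨x.2, rfl⟩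
    | succ N ih =>
      intro π s
      rw [valueUpTo_succ, M.valueUpTo_succ N, ← Finset.sum_sub_distrib]
      simp_rw [← smul_sub, backup_sub]
      refine norm_mul_sum_smul_le _ fun a => norm_mul_sum_smul_le _ fun x => ?_
      refine (hcontr _ _).trans ?_
      calc β * _ ≤ β * (K * β ^ N) := mul_le_mul_of_nonneg_left (ih _ _) hβ0
        _ = K * β ^ (N + 1) := by ring
  have hinv : ∀ x : Fin d → ℝ, ‖x‖ ≤ ‖w⁻¹‖ * ‖w * x‖ := fun x => by
    have : w⁻¹ * (w * x) = x := by
      ext k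
      simp [(hw k).ne']
    simpa [this] using norm_mul_le w⁻¹ (w * x)
  have hdist : ∀ (π : Policy S A E) s N,
      dist (M.valueUpTo N π s) (M.valueUpTo (N + 1) π s) ≤ ‖w⁻¹‖ * K * β ^ N := by
    intro π s N
    rw [dist_comm, dist_eq_norm, mul_assoc]
    exact (hinv _).trans (mul_le_mul_of_nonneg_left (hstep N π s) (norm_nonneg _))
  refine ⟨‖w⁻¹‖ * K / (1 - β), fun π s => ?_⟩
  obtain ⟨v, hv⟩ := cauchySeq_tendsto_of_complete
    (cauchySeq_of_le_geometric β _ hβ1 (hdist π s))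
  refine ⟨v, hv, ?_⟩
  have := dist_le_of_le_geometric_of_tendsto₀ β _ hβ1 (hdist π s) hv
  rwa [valueUpTo_zero, dist_zero_left] at this

variable {M} (hdisc : ∀ (e : E) (i : Fin d), M.mult e i i < 1)
include hdisc

theorem tendsto_valueUpTo (π : Policy S A E) (s : S) :
    Tendsto (fun N => M.valueUpTo N π s) atTop (𝓝 (M.V π s)) := by
  obtain ⟨B, hB⟩ := M.exists_tendsto_valueUpTo hdisc
  obtain ⟨v, hv, -⟩ := hB π s
  exact tendsto_nhds_limUnder ⟨v, hv⟩

theorem exists_norm_V_le : ∃ B : ℝ, ∀ (π : Policy S A E) (s : S), ‖M.V π s‖ ≤ B := by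
  obtain ⟨B, hB⟩ := M.exists_tendsto_valueUpTo hdisc
  refine ⟨B, fun π s => ?_⟩
  obtain ⟨v, hv, hvB⟩ := hB π s
  rwa [tendsto_nhds_unique (tendsto_valueUpTo hdisc π s) hv]

theorem tendsto_eventLawAct_backup (π : Policy S A E) (s : S) (a : A) :
    Tendsto (fun N => expect (M.eventLawAct N π s a) M.utility) atTop
      (𝓝 (M.backup (fun x => M.V (π.after s a x.2) x.1) s a)) := by
  simp_rw [expect_eventLawAct]
  exact ((M.continuous_backup s a).tendsto _).comp
    (tendsto_pi_nhds.2 fun x => tendsto_valueUpTo hdisc _ _)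

theorem Q_eq_backup (π : Policy S A E) (s : S) (a : A) :
    M.Q π s a = M.backup (fun x => M.V (π.after s a x.2) x.1) s a :=
  (tendsto_eventLawAct_backup hdisc π s a).limUnder_eq

theorem V_eq_sum_backup (π : Policy S A E) (s : S) :
    M.V π s = ∑ a, (π [] s a).toReal •
      M.backup (fun x => M.V (π.after s a x.2) x.1) s a := by
  refine tendsto_nhds_unique ((tendsto_add_atTop_iff_nat 1).2 (tendsto_valueUpTo hdisc π s)) ?_
  simp_rw [valueUpTo_succ]
  exact tendsto_finsetSum _ fun a _ => Tendsto.const_smul (((M.continuous_backup s a).tendsto _).comp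
    (tendsto_pi_nhds.2 fun x => tendsto_valueUpTo hdisc _ _)) _

/-! ### Comparison and existence of optimal values -/

theorem Q_stationary (π : S → PMF A) (s : S) (a : A) :
    M.Q (stationary E π) s a = M.backup (fun x => M.V (stationary E π) x.1) s a :=
  Q_eq_backup hdisc _ _ _

theorem V_stationary (π : S → PMF A) (s : S) :
    M.V (stationary E π) s = expect (π s) (M.Q (stationary E π) s) := by
  rw [expect_eq_sum, V_eq_sum_backup hdisc]
  exact Finset.sum_congr rfl fun a _ => by rw [Q_stationary hdisc]; rfl

/-- Comparison principle over states, for a stationary policy. -/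
theorem lexNonneg_of_stationary (π : S → PMF A) {D : S → Fin d → ℝ}
    (h : ∀ s, LexNonneg (D s - ∑ a, (π s a).toReal •
      ∑ x, (M.trans s a x).toReal • M.mult x.2 *ᵥ D x.1)) (s : S) : LexNonneg (D s) := by
  obtain ⟨B, hB⟩ := (Set.finite_range fun s => ‖D s‖).bddAbove
  refine lexNonneg_of_sub_average (ι := A × S × E) (fun s => hB ⟨s, rfl⟩)
    (p := fun s i => (π s i.1).toReal * (M.trans s i.1 i.2).toReal)
    (fun _ _ => by positivity) (fun s => ?_) (fun i => M.mult_mem i.2.2) (fun i => hdisc i.2.2)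
    (next := fun _ i => i.2.1) (fun s => ?_) s
  · rw [Fintype.sum_prod_type]
    simp_rw [← Finset.mul_sum, PMF.sum_toReal, mul_one]
    exact (π s).sum_toReal
  · convert h s using 2
    rw [Fintype.sum_prod_type]
    simp_rw [mul_smul, ← Finset.smul_sum]

/-- A function dominating all its one-step backups dominates the value of every policy. -/
theorem lexNonneg_sub_V {W : S → Fin d → ℝ}
    (hW : ∀ s a, LexNonneg (W s - M.backup (fun x => W x.1) s a)) (π : Policy S A E) (s : S) :
    LexNonneg (W s - M.V π s) := by
  obtain ⟨B, hB⟩ := (Set.finite_range fun s => ‖W s‖).bddAbove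
  obtain ⟨B', hB'⟩ := exists_norm_V_le hdisc
  refine lexNonneg_of_sub_average (X := Policy S A E × S) (ι := A × S × E)
    (D := fun z => W z.2 - M.V z.1 z.2) (B := B + B')
    (fun z => (norm_sub_le _ _).trans (add_le_add (hB ⟨z.2, rfl⟩) (hB' _ _)))
    (p := fun z i => (z.1 [] z.2 i.1).toReal * (M.trans z.2 i.1 i.2).toReal)
    (fun _ _ => by positivity) (fun z => ?_) (fun i => M.mult_mem i.2.2) (fun i => hdisc i.2.2)
    (next := fun z i => (z.1.after z.2 i.1 i.2.2, i.2.1)) (fun z => ?_) (π, s)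
  · rw [Fintype.sum_prod_type]
    simp_rw [← Finset.mul_sum, PMF.sum_toReal, mul_one]
    exact PMF.sum_toReal _
  · obtain ⟨π, s⟩ := z
    have key : W s - M.V π s - ∑ i : A × S × E,
        ((π [] s i.1).toReal * (M.trans s i.1 i.2).toReal) •
          M.mult i.2.2 *ᵥ (W i.2.1 - M.V (π.after s i.1 i.2.2) i.2.1) =
        ∑ a, (π [] s a).toReal • (W s - M.backup (fun x => W x.1) s a) := by
      rw [Fintype.sum_prod_type]
      simp_rw [mul_smul, ← Finset.smul_sum]
      simp_rw [← M.backup_sub (fun x => W x.1), smul_sub, Finset.sum_sub_distrib,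
        PMF.sum_smul_const, ← V_eq_sum_backup hdisc]
      abel
    change LexNonneg (W s - M.V π s - ∑ i : A × S × E,
        ((π [] s i.1).toReal * (M.trans s i.1 i.2).toReal) •
          M.mult i.2.2 *ᵥ (W i.2.1 - M.V (π.after s i.1 i.2.2) i.2.1))
    rw [key]
    exact LexNonneg.sum fun a _ => (hW s a).smul ENNReal.toReal_nonneg

/-- The defect of `V - W` in the comparison principle is the Bellman residual of `W`, which no
longer involves `V`. -/
theorem V_stationary_sub (π : S → PMF A) (W : S → Fin d → ℝ) (s : S) :
    M.V (stationary E π) s - W s - ∑ a, (π s a).toReal •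
      ∑ x, (M.trans s a x).toReal • M.mult x.2 *ᵥ (M.V (stationary E π) x.1 - W x.1) =
    expect (π s) (M.backup (fun x => W x.1) s) - W s := by
  simp_rw [← M.backup_sub (fun x => M.V (stationary E π) x.1), smul_sub, Finset.sum_sub_distrib,
    expect_eq_sum]
  rw [V_stationary hdisc, expect_eq_sum]
  simp_rw [Q_stationary hdisc]
  abel

/-- A fixed point of the Bellman operator of a stationary policy is its value function. -/
theorem V_stationary_eq {π : S → PMF A} {W : S → Fin d → ℝ}
    (hW : ∀ s, expect (π s) (M.backup (fun x => W x.1) s) = W s) :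
    M.V (stationary E π) = W := by
  funext s
  -- Both differences have zero defect, so comparison applies in both directions.
  refine toLex_inj.1 (le_antisymm ?_ ?_) <;> rw [toLex_le_toLex_iff_lexNonneg]
  · refine lexNonneg_of_stationary hdisc π (D := fun s => W s - M.V (stationary E π) s)
      (fun s => ?_) s
    have h := V_stationary_sub hdisc π W s
    rw [hW, sub_self] at h
    simp_rw [← neg_sub (M.V _ _), Matrix.mulVec_neg, smul_neg, Finset.sum_neg_distrib, smul_neg,
      Finset.sum_neg_distrib]
    rw [← neg_sub', h, neg_zero]
    exact lexNonneg_zero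
  · refine lexNonneg_of_stationary hdisc π (D := fun s => M.V (stationary E π) s - W s)
      (fun s => ?_) s
    rw [V_stationary_sub hdisc, hW, sub_self]
    exact lexNonneg_zero

/-- Some deterministic stationary policy satisfies the lexicographic Bellman optimality
equation. -/
theorem exists_bellman_optimal [Nonempty A] :
    ∃ f : S → A, (∀ s, M.V (stationary E fun s => PMF.pure (f s)) s =
        M.Q (stationary E fun s => PMF.pure (f s)) s (f s)) ∧
      ∀ s a, toLex (M.Q (stationary E fun s => PMF.pure (f s)) s a) ≤
        toLex (M.V (stationary E fun s => PMF.pure (f s)) s) := by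
  let P : (S → A) → Policy S A E := fun f => stationary E fun s => PMF.pure (f s)
  have hV : ∀ f s, M.V (P f) s = M.Q (P f) s (f s) := fun f s => by
    rw [V_stationary hdisc, expect_pure]
  -- Maximal for the pointwise order over states; a greatest element is not yet available.
  obtain ⟨_, ⟨f, rfl⟩, hf⟩ := (Set.finite_range fun f : S → A =>
    fun s => toLex (M.V (P f) s)).exists_maximal (Set.range_nonempty _)
  choose g hg using fun s => Finite.exists_max fun a => toLex (M.Q (P f) s a)
  have himp : ∀ s, LexNonneg (M.V (P g) s - M.V (P f) s) := by
    refine lexNonneg_of_stationary hdisc (fun s => PMF.pure (g s))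
      (D := fun s => M.V (P g) s - M.V (P f) s) fun s => ?_
    rw [V_stationary_sub hdisc, expect_pure, ← Q_stationary hdisc, ← toLex_le_toLex_iff_lexNonneg]
    rw [hV]
    exact hg s (f s)
  have hle := hf ⟨g, rfl⟩ fun s => toLex_le_toLex_iff_lexNonneg.2 (himp s)
  have heq : M.V (P g) = M.V (P f) := funext fun s =>
    toLex_inj.1 (le_antisymm (hle s) (toLex_le_toLex_iff_lexNonneg.2 (himp s)))
  refine ⟨f, hV f, fun s a => (hg s a).trans_eq ?_⟩
  change _ = toLex (M.V (P f) s)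
  -- Equal values give equal Q-functions, so the best action value at `s`, attained at `g s`, is the
  -- common value.
  rw [← heq, hV, Q_stationary hdisc, Q_stationary hdisc]
  change _ = toLex (M.backup (fun x => M.V (P g) x.1) s (g s))
  rw [heq]

end Convergence

end LMDP

/-! ### The fundamental theorem -/

theorem mainTheorem5 {S A E : Type*} [Finite S] [Finite A] [Finite E] {d : ℕ}
    (M : LMDP S A E d) (hdisc : ∀ (e : E) (i : Fin d), M.mult e i i < 1) :
    -- the expected returns converge
    (∀ (π : Policy S A E) (s : S),
      Tendsto (fun N => expect (M.eventLaw N π s) M.utility) atTop (𝓝 (M.V π s))) ∧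
    (∀ (π : Policy S A E) (s : S) (a : A),
      Tendsto (fun N => expect (M.eventLawAct N π s a) M.utility) atTop (𝓝 (M.Q π s a))) ∧
    -- optimality within any class of policies that contains the stationary ones
    ∀ C : Set (Policy S A E), (∀ π : S → PMF A, stationary E π ∈ C) →
      (∃ Qstar : S → A → Fin d → ℝ, M.IsOptimalQ C Qstar) ∧
      ∀ Qstar : S → A → Fin d → ℝ, M.IsOptimalQ C Qstar →
        ∀ π : S → PMF A,
          (M.IsUniformlyOptimal C (stationary E π) ↔ IsGreedy Qstar π) ∧
          (IsGreedy Qstar π → ∀ s a, M.Q (stationary E π) s a = Qstar s a) := by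
  cases nonempty_fintype S
  cases nonempty_fintype A
  cases nonempty_fintype E
  refine ⟨LMDP.tendsto_valueUpTo hdisc, fun π s a => ?_, fun C hC => ?_⟩
  · rw [LMDP.Q_eq_backup hdisc]
    exact LMDP.tendsto_eventLawAct_backup hdisc π s a
  rcases isEmpty_or_nonempty S with hS | hS
  · exact ⟨⟨fun s => isEmptyElim s, fun s => isEmptyElim s⟩, fun _ _ π =>
      ⟨⟨fun _ s => isEmptyElim s, fun _ s => isEmptyElim s⟩, fun _ s => isEmptyElim s⟩⟩
  -- Without actions but with a state, no stationary policy exists.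
  rcases isEmpty_or_nonempty A with hA | hA
  · exact ⟨⟨fun _ a => isEmptyElim a, fun _ a => isEmptyElim a⟩, fun _ _ π =>
      isEmptyElim (π hS.some).support_nonempty.some⟩
  obtain ⟨f, hf, hopt⟩ := LMDP.exists_bellman_optimal hdisc
  set ρ : Policy S A E := stationary E fun s => PMF.pure (f s) with hρ
  have hQρ : ∀ s a, M.Q ρ s a = M.backup (fun x => M.V ρ x.1) s a := LMDP.Q_stationary hdisc _
  have hVle : ∀ (π : Policy S A E) s, LexNonneg (M.V ρ s - M.V π s) :=
    LMDP.lexNonneg_sub_V hdisc fun s a => by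
      rw [← hQρ]
      exact toLex_le_toLex_iff_lexNonneg.1 (hopt s a)
  have hOpt : M.IsOptimalQ C (M.Q ρ) := by
    refine fun s a => ⟨⟨ρ, hC _, rfl⟩, ?_⟩
    rintro _ ⟨π, -, rfl⟩
    change toLex (M.Q π s a) ≤ toLex (M.Q ρ s a)
    rw [toLex_le_toLex_iff_lexNonneg, hQρ, LMDP.Q_eq_backup hdisc, LMDP.backup_sub]
    exact LexNonneg.sum fun x _ =>
      ((hVle _ _).mulVec (M.mult_mem _)).smul ENNReal.toReal_nonneg
  refine ⟨⟨_, hOpt⟩, fun Qstar hQ π => ?_⟩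
  -- Greatest elements are unique.
  obtain rfl : Qstar = M.Q ρ := funext₂ fun s a => toLex_inj.1 ((hQ s a).unique (hOpt s a))
  have hmax : ∀ s, IsGreatest (Set.range fun a => toLex (M.Q ρ s a)) (toLex (M.V ρ s)) := fun s =>
    ⟨⟨f s, by rw [hf]⟩, by rintro _ ⟨a, rfl⟩; exact hopt s a⟩
  have hQeq : M.V (stationary E π) = M.V ρ → ∀ s a, M.Q (stationary E π) s a = M.Q ρ s a :=
    fun h s a => by rw [LMDP.Q_stationary hdisc, h, hQρ]
  have hgreedy : IsGreedy (M.Q ρ) π → M.V (stationary E π) = M.V ρ := fun h =>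
    LMDP.V_stationary_eq hdisc fun s => by
      have := toLex_inj.1 ((h s).unique (hmax s))
      rwa [funext (hQρ s)] at this
  refine ⟨⟨fun h s => ?_, fun h s π' _ => ?_⟩, fun h => hQeq (hgreedy h)⟩
  -- Optimality is tested against `ρ`, which lies in `C` because it is stationary.
  · have hV : M.V (stationary E π) = M.V ρ := funext fun s => toLex_inj.1
      (le_antisymm (toLex_le_toLex_iff_lexNonneg.2 (hVle _ s)) (h s ρ (hC _)))
    rw [← funext (hQeq hV s), ← LMDP.V_stationary hdisc, hV, funext (hQeq hV s)]
    exact hmax s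
  · rw [hgreedy h]
    exact toLex_le_toLex_iff_lexNonneg.2 (hVle π' s)
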